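/- **Definitions.** Let $X$ be a metric space with a base point $x_0$ (nothing below depends on its choice); $B_r(x)$ denotes the open ball. Subsets $A,B\subset X$ are *asymptotically disjoint* if $\lim_{r\to\infty} d(A\setminus B_r(x_0),\,B\setminus B_r(x_0))=\infty$, where the distance to the empty set is $\infty$. A map $\phi:X\to[0,1]$ is *slowly oscillating* if for all $r>0$ and $\varepsilon>0$ there is $D>0$ such that $\operatorname{diam}\phi(B_r(x))<\varepsilon$ whenever $d(x,x_0)\ge D$. Let $C_h(X)$ be the set of continuous slowly oscillating maps $X\to[0,1]$, let $\Phi:X\to[0,1]^{C_h(X)}$, $\Phi(x)=(\phi(x))_{\phi\in C_h(X)}$, and let $cX$ be the closure of $\Phi(X)$ (the *Higson compactification*). The *Higson corona* is $\nu X=\bigcap_{r>0}\overline{\Phi(X\setminus B_r(x_0))}$; if $X$ is proper (all closed balls are compact), this is the remainder $cX\setminus \Phi(X)$. For $C\subset X$ put $C'=\overline{\Phi(C)}\cap\nu X$. A closed subset $C\subset X$ is an *asymptotic separator* for asymptotically disjoint sets $A,B\subset X$ if there are disjoint open sets $U_1,U_2\subset\nu X$ with $\nu X\setminus C'=U_1\cup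 U_2$, $A'\subset U_1$ and $B'\subset U_2$. The *transfinite asymptotic large inductive dimension* $\operatorname{trasInd}X$, with values in $\{-1\}\cup\{\text{ordinals}\}\cup\{\infty\}$, is defined recursively as follows: $\operatorname{trasInd}X\le-1$ if and only if $X$ is bounded; for an ordinal $\alpha$, $\operatorname{trasInd}X\le\alpha$ if and only if for every two asymptotically disjoint sets $A,B\subset X$ there is an asymptotic separator $C\subset X$ for $A$ and $B$, itself regarded as a metric space, such that $\operatorname{trasInd}C\le\beta$ for some $\beta<\alpha$ (where $\beta=-1$ is allowed). $\operatorname{trasInd}X$ is the least $\alpha$ with $\operatorname{trasInd}X\le\alpha$, and $\operatorname{trasInd}X=\infty$ if there is no such $\alpha$. **Theorem 4.** Let $X$ be a proper metric space and let $Y\subset X$ be any subset, regarded as a metric space with the restricted metric. Then $\operatorname{trasInd}Y\le\operatorname{trasInd}X$. -/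

import Mathlib

open Set

universe u

section Asymptotics

variable {X : Type u} [MetricSpace X]

/-- Two subsets `A` and `B` are asymptotically disjoint if the distance between
`A \ B_r(x₀)` and `B \ B_r(x₀)` tends to infinity with `r` (the distance to the empty set
being infinite). This distance is monotone in `r`, and the condition does not depend on the
base point `x₀`; quantifying over all base points also covers the empty space. -/
def AsymptoticallyDisjoint (A B : Set X) : Prop :=
  ∀ x₀ : X, ∀ R : ℝ, ∃ r : ℝ,
    ∀ a ∈ A \ Metric.ball x₀ r, ∀ b ∈ B \ Metric.ball x₀ r, R ≤ dist a b

/-- Slowly oscillating maps `X → [0,1]`. The condition does not depend on the base point. -/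
def SlowlyOscillating (φ : X → unitInterval) : Prop :=
  ∀ x₀ : X, ∀ r > 0, ∀ ε > 0, ∃ D > 0, ∀ x : X, D ≤ dist x x₀ →
    Metric.diam (φ '' Metric.ball x r) < ε

variable (X) in
/-- The set of all continuous slowly oscillating functions `X → [0,1]`. -/
def HigsonFun : Type u :=
  {φ : C(X, unitInterval) // SlowlyOscillating φ}

/-- The evaluation map of `X` into the cube `[0,1]^(C_h(X))`. -/
def higsonMap (x : X) : HigsonFun X → unitInterval :=
  fun φ => φ.1 x

variable (X) in
/-- The Higson compactification: the closure of the image of `X` in the cube. -/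
def higsonCompactification : Set (HigsonFun X → unitInterval) :=
  closure (range (higsonMap (X := X)))

variable (X) in
/-- The Higson corona: the points of the Higson compactification that lie in the closure of the
complement of every bounded set. For a proper space this is the remainder of the Higson
compactification, see `higsonCoronaSet_eq_diff`; in this form the definition is also meaningful
for a subset of a proper metric space that is not closed. -/
def higsonCoronaSet : Set (HigsonFun X → unitInterval) :=
  {p | p ∈ higsonCompactification X ∧
    ∀ B : Set X, Bornology.IsBounded B → p ∈ closure (higsonMap '' Bᶜ)}

theorem slowlyOscillating_bump (x : X) :
    SlowlyOscillating (fun y : X => projIcc (0 : ℝ) 1 zero_le_one (1 - dist y x)) := by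
  intro x₀ r hr ε hε
  refine ⟨1 + r + dist x x₀, by positivity, fun y hy => ?_⟩
  refine lt_of_le_of_lt (Metric.diam_le_of_forall_dist_le le_rfl ?_) hε
  have key : ∀ z ∈ Metric.ball y r,
      projIcc (0 : ℝ) 1 zero_le_one (1 - dist z x) = ⟨0, by simp⟩ := by
    intro z hz
    refine projIcc_of_le_left _ ?_
    have h1 := dist_triangle y z x₀
    have h2 := dist_triangle z x x₀
    have h3 : dist z y < r := hz
    rw [dist_comm] at h3
    linarith
  rintro _ ⟨z, hz, rfl⟩ _ ⟨w, hw, rfl⟩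
  simp only [key z hz, key w hw, dist_self, le_refl]

theorem continuous_higsonMap : Continuous (higsonMap (X := X)) :=
  continuous_pi fun φ => φ.1.continuous

/-- For a proper metric space the corona is the complement of the space in its Higson
compactification. -/
theorem higsonCoronaSet_eq_diff [ProperSpace X] :
    higsonCoronaSet X = higsonCompactification X \ range (higsonMap (X := X)) := by
  ext p
  constructor
  · rintro ⟨hp, hB⟩
    refine ⟨hp, ?_⟩
    rintro ⟨x, rfl⟩
    let φ : HigsonFun X :=
      ⟨⟨fun y : X => projIcc (0 : ℝ) 1 zero_le_one (1 - dist y x), by fun_prop⟩,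
        slowlyOscillating_bump x⟩
    have hcl : IsClosed {q : HigsonFun X → unitInterval | q φ = 0} :=
      isClosed_eq (continuous_apply φ) continuous_const
    have hsub : higsonMap '' (Metric.ball x 1)ᶜ ⊆
        {q : HigsonFun X → unitInterval | q φ = 0} := by
      rintro _ ⟨y, hy, rfl⟩
      have hy' : 1 ≤ dist y x := by simpa using hy
      exact projIcc_of_le_left zero_le_one (by linarith)
    have h0 : higsonMap x φ = 0 := closure_minimal hsub hcl (hB _ Metric.isBounded_ball)
    have h1 : higsonMap x φ = 1 := by
      change projIcc (0 : ℝ) 1 zero_le_one (1 - dist x x) = 1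
      exact projIcc_of_right_le zero_le_one (by simp)
    rw [h0] at h1
    exact zero_ne_one h1
  · rintro ⟨hp, hr⟩
    refine ⟨hp, fun B hB => ?_⟩
    have hc : IsClosed (higsonMap '' closure B) :=
      (hB.isCompact_closure.image continuous_higsonMap).isClosed
    have hsub : range (higsonMap (X := X)) ⊆
        higsonMap '' closure B ∪ closure (higsonMap '' Bᶜ) := by
      rintro _ ⟨y, rfl⟩
      by_cases hy : y ∈ B
      · exact Or.inl ⟨y, subset_closure hy, rfl⟩
      · exact Or.inr (subset_closure ⟨y, hy, rfl⟩)
    rcases closure_minimal hsub (hc.union isClosed_closure) hp with ⟨y, -, h⟩ | h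
    · exact absurd ⟨y, h⟩ hr
    · exact h

variable (X) in
/-- The Higson corona `νX` as a topological space. -/
abbrev HigsonCorona : Type u :=
  higsonCoronaSet X

/-- The trace `C'` of a subset `C ⊆ X` in the Higson corona. -/
def higsonTrace (C : Set X) : Set (HigsonCorona X) :=
  {p | (p : HigsonFun X → unitInterval) ∈ closure (higsonMap '' C)}

/-- `C` is a partition between `A₁` and `A₂` in a topological space. -/
def IsPartitionBetween {T : Type u} [TopologicalSpace T] (A₁ A₂ C : Set T) : Prop :=
  ∃ U₁ U₂ : Set T, IsOpen U₁ ∧ IsOpen U₂ ∧ Disjoint U₁ U₂ ∧ Cᶜ = U₁ ∪ U₂ ∧ A₁ ⊆ U₁ ∧ A₂ ⊆ U₂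

/-- A closed set `C` is an asymptotic separator for `A` and `B` if its trace is a partition
between the traces of `A` and `B` in the Higson corona. -/
def IsAsymptoticSeparator (A B C : Set X) : Prop :=
  IsClosed C ∧ IsPartitionBetween (higsonTrace A) (higsonTrace B) (higsonTrace C)

end Asymptotics

/-- `TrasIndLE α X` says that `trasInd X ≤ α`, where `α` is `-1` (written `⊥`) or an ordinal.
See `trasIndLE_bot` and `trasIndLE_coe` for the two clauses of the recursion. -/
def TrasIndLE (α : WithBot Ordinal.{u}) (X : Type u) [MetricSpace X] : Prop :=
  (α = ⊥ → Bornology.IsBounded (univ : Set X)) ∧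
  (α ≠ ⊥ → ∀ A B : Set X, AsymptoticallyDisjoint A B →
    ∃ C : Set X, IsAsymptoticSeparator A B C ∧
      ∃ (β : WithBot Ordinal.{u}) (_ : β < α), TrasIndLE β C)
termination_by (wellFounded_lt (α := WithBot Ordinal.{u})).wrap α
decreasing_by assumption

theorem trasIndLE_bot (X : Type u) [MetricSpace X] :
    TrasIndLE ⊥ X ↔ Bornology.IsBounded (univ : Set X) := by
  rw [TrasIndLE]
  simp

theorem trasIndLE_coe (α : Ordinal.{u}) (X : Type u) [MetricSpace X] :
    TrasIndLE (α : WithBot Ordinal.{u}) X ↔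
      ∀ A B : Set X, AsymptoticallyDisjoint A B →
        ∃ C : Set X, IsAsymptoticSeparator A B C ∧
          ∃ β : WithBot Ordinal.{u}, β < (α : WithBot Ordinal.{u}) ∧ TrasIndLE β C := by
  rw [TrasIndLE]
  simp

open Classical in
/-- The transfinite asymptotic large inductive dimension: the least `α` in `{-1} ∪ Ordinal`
with `trasInd X ≤ α`, and `∞` (written `⊤`) if there is none. The value `-1` is written `⊥`. -/
noncomputable def trasInd (X : Type u) [MetricSpace X] : WithTop (WithBot Ordinal.{u}) :=
  if h : {α : WithBot Ordinal.{u} | TrasIndLE α X}.Nonempty then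
    ((wellFounded_lt.min {α : WithBot Ordinal.{u} | TrasIndLE α X} h : WithBot Ordinal.{u}) :
      WithTop (WithBot Ordinal.{u}))
  else ⊤

/-! ### Asymptotic disjointness versus disjoint traces in the corona -/

section Asymptotics

variable {X : Type u} [MetricSpace X]

/-! A separator `C` in `X` of `A, B ⊆ Y` need not meet `Y`, so it cannot simply be intersected with
`Y`. Instead, a discrete shadow `D ⊆ Y` of `C` is built: among the points of `Y` closer to `C` than
to `A ∪ B`, take a net whose mesh is proportional to the distance to `C`. Sending each net point to
a nearby point of `C` is bilipschitz, because the net is sparse compared with the displacement. As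
`D` is only bilipschitz to a subset of `C`, the induction on `α` runs over all bilipschitz maps `j :
Y → X` (`IsBilipschitz.trasIndLE`); the inclusion is the case `L = 1`.

That `D` separates is checked metrically, since asymptotic disjointness is the same as disjointness
of traces in the corona: `D` stays away from `A ∪ B`, and any set far from `D` has image far from
`C`. Hence the trace of `D` contains the preimage of the trace of `C` under the corona map, and the
open sets pull back. -/

theorem isBounded_of_isEmpty [IsEmpty X] (S : Set X) : Bornology.IsBounded S := by
  rw [S.eq_empty_of_isEmpty]
  exact Bornology.isBounded_empty

/-- A base point free form of asymptotic disjointness. -/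
theorem asymptoticallyDisjoint_iff {A B : Set X} :
    AsymptoticallyDisjoint A B ↔
      ∀ R : ℝ, Bornology.IsBounded {a | a ∈ A ∧ ∃ b ∈ B, dist a b ≤ R} := by
  constructor
  · intro h R
    rcases isEmpty_or_nonempty X with _ | ⟨⟨x₀⟩⟩
    · exact isBounded_of_isEmpty _
    · obtain ⟨r, hr⟩ := h x₀ (R + 1)
      refine (Metric.isBounded_ball (x := x₀) (r := r + |R| + 1)).subset ?_
      rintro a ⟨ha, b, hb, hab⟩
      by_contra hfar
      have hfar' : r + |R| + 1 ≤ dist a x₀ := by simpa using hfar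
      have h1 := dist_triangle a b x₀
      have h2 := le_abs_self R
      have h3 := abs_nonneg R
      have := hr a ⟨ha, by simp; linarith⟩ b ⟨hb, by simp; linarith⟩
      linarith
  · intro h x₀ R
    obtain ⟨r, hr⟩ := (h R).subset_ball x₀
    refine ⟨r, fun a ha b hb => ?_⟩
    by_contra hlt
    exact ha.2 (hr ⟨ha.1, b, hb.1, (not_le.1 hlt).le⟩)

theorem slowlyOscillating_of_dist_lt {φ : X → unitInterval}
    (h : ∀ x₀ : X, ∀ r > 0, ∀ ε > 0, ∃ D : ℝ, ∀ x : X, D ≤ dist x x₀ → ∀ y ∈ Metric.ball x r,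
      dist (φ y) (φ x) ≤ ε) : SlowlyOscillating φ := by
  intro x₀ r hr ε hε
  obtain ⟨D, hD⟩ := h x₀ r hr (ε / 4) (by positivity)
  refine ⟨max D 1, by positivity, fun x hx => ?_⟩
  refine lt_of_le_of_lt (Metric.diam_le_of_forall_dist_le (C := ε / 2) (by positivity) ?_)
    (half_lt_self hε)
  rintro _ ⟨y, hy, rfl⟩ _ ⟨z, hz, rfl⟩
  have h1 := hD x ((le_max_left _ _).trans hx) y hy
  have h2 := hD x ((le_max_left _ _).trans hx) z hz
  have := dist_triangle_right (φ y) (φ z) (φ x)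
  linarith

/-- A point of the corona is not a limit of points of a bounded set. -/
theorem not_mem_closure_of_isBounded {p : HigsonFun X → unitInterval} (hp : p ∈ higsonCoronaSet X)
    {S : Set X} (hS : Bornology.IsBounded S) : p ∉ closure (higsonMap '' S) := by
  intro hpS
  rcases isEmpty_or_nonempty X with _ | ⟨⟨x₀⟩⟩
  · simp [S.eq_empty_of_isEmpty] at hpS
  obtain ⟨r, hr⟩ := hS.subset_ball x₀
  -- A cutoff equal to 1 on a ball containing `S` and 0 off a larger ball; its coordinate at `p`
  -- would be both 1 and 0.
  let f : X → unitInterval := fun x => projIcc (0 : ℝ) 1 zero_le_one (r + 1 - dist x x₀)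
  have hf : SlowlyOscillating f := by
    refine slowlyOscillating_of_dist_lt fun y₀ ρ hρ ε hε => ⟨r + 1 + ρ + dist x₀ y₀, ?_⟩
    intro x hx y hy
    have hy' : dist y x < ρ := hy
    have h1 := dist_triangle x x₀ y₀
    have h2 := dist_triangle_left x x₀ y
    have hfx : f x = ⟨0, by simp⟩ := projIcc_of_le_left _ (by linarith)
    have hfy : f y = ⟨0, by simp⟩ := projIcc_of_le_left _ (by linarith)
    rw [hfx, hfy, dist_self]
    exact hε.le
  let φ : HigsonFun X := ⟨⟨f, by fun_prop⟩, hf⟩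
  have h1 : p φ = 1 := by
    refine closure_minimal (t := {q : HigsonFun X → unitInterval | q φ = 1}) ?_
      (isClosed_eq (continuous_apply φ) continuous_const) hpS
    rintro _ ⟨y, hy, rfl⟩
    have : dist y x₀ < r := hr hy
    exact projIcc_of_right_le zero_le_one (by linarith)
  have h0 : p φ = 0 := by
    refine closure_minimal (t := {q : HigsonFun X → unitInterval | q φ = 0}) ?_
      (isClosed_eq (continuous_apply φ) continuous_const)
      (hp.2 _ (Metric.isBounded_ball (x := x₀) (r := r + 1)))
    rintro _ ⟨y, hy, rfl⟩
    have : r + 1 ≤ dist y x₀ := by simpa using hy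
    exact projIcc_of_le_left zero_le_one (by linarith)
  rw [h0] at h1
  exact zero_ne_one h1

theorem mem_closure_diff_of_isBounded {p : HigsonFun X → unitInterval}
    (hp : p ∈ higsonCoronaSet X) {A S : Set X} (hS : Bornology.IsBounded S)
    (hA : p ∈ closure (higsonMap '' A)) : p ∈ closure (higsonMap '' (A \ S)) := by
  have hsub : higsonMap '' A ⊆ higsonMap '' (A \ S) ∪ higsonMap '' S := by
    rw [← image_union]
    exact image_mono (by simp)
  have := closure_mono hsub hA
  rw [closure_union] at this
  exact this.resolve_right (not_mem_closure_of_isBounded hp hS)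

/-- The quotient `u / (u + v)` is slowly oscillating if `u` and `v` are nonnegative `1`-Lipschitz
functions whose sum tends to infinity. -/
theorem slowlyOscillating_div {u v : X → ℝ} (hu : LipschitzWith 1 u) (hv : LipschitzWith 1 v)
    (hu0 : ∀ x, 0 ≤ u x) (hv0 : ∀ x, 0 ≤ v x) {φ : X → unitInterval}
    (hφ : ∀ x, (φ x : ℝ) = u x / (u x + v x))
    (hlim : ∀ (x₀ : X) (M : ℝ), ∃ D : ℝ, ∀ x, D ≤ dist x x₀ → M ≤ u x + v x) :
    SlowlyOscillating φ := by
  refine slowlyOscillating_of_dist_lt fun x₀ r hr ε hε => ?_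
  -- Moving from `x` to `y` lowers `u + v` by at most `2 * r`, leaving the `r / ε` needed in the
  -- denominator at `y`.
  obtain ⟨D, hD⟩ := hlim x₀ (2 * r + r / ε)
  refine ⟨D, fun x hx y hy => ?_⟩
  have hxy : dist y x ≤ r := (Metric.mem_ball.1 hy).le
  have h1 : |u y - u x| ≤ r := by
    have := hu.dist_le_mul y x
    simp only [Real.dist_eq, NNReal.coe_one, one_mul] at this
    linarith
  have h2 : |v y - v x| ≤ r := by
    have := hv.dist_le_mul y x
    simp only [Real.dist_eq, NNReal.coe_one, one_mul] at this
    linarith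
  have hpos : 0 < r / ε := by positivity
  have hx' : 2 * r + r / ε ≤ u x + v x := hD x hx
  have hy' : r / ε ≤ u y + v y := by
    have := abs_le.1 h1
    have := abs_le.1 h2
    linarith
  have hxp : 0 < u x + v x := by linarith
  have hyp : 0 < u y + v y := by linarith
  rw [Subtype.dist_eq, Real.dist_eq, hφ, hφ]
  have hnum : u y / (u y + v y) - u x / (u x + v x)
      = (v x * (u y - u x) - u x * (v y - v x)) / ((u y + v y) * (u x + v x)) := by
    field_simp
    ring
  rw [hnum, abs_div, abs_of_pos (mul_pos hyp hxp), div_le_iff₀ (mul_pos hyp hxp)]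
  calc |v x * (u y - u x) - u x * (v y - v x)|
      ≤ |v x * (u y - u x)| + |u x * (v y - v x)| := abs_sub _ _
    _ = v x * |u y - u x| + u x * |v y - v x| := by
        rw [abs_mul, abs_mul, abs_of_nonneg (hu0 x), abs_of_nonneg (hv0 x)]
    _ ≤ v x * r + u x * r :=
        add_le_add (mul_le_mul_of_nonneg_left h1 (hv0 x)) (mul_le_mul_of_nonneg_left h2 (hu0 x))
    _ = r * (u x + v x) := by ring
    _ ≤ ε * (u y + v y) * (u x + v x) := by
        refine mul_le_mul_of_nonneg_right ?_ hxp.le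
        rw [div_le_iff₀ hε] at hy'
        linarith
    _ = ε * ((u y + v y) * (u x + v x)) := by ring

/-- The Urysohn quotient of distances to the two sets is slowly oscillating, and its coordinate
tells the traces apart. -/
theorem AsymptoticallyDisjoint.disjoint_higsonTrace {A B : Set X}
    (h : AsymptoticallyDisjoint A B) : Disjoint (higsonTrace A) (higsonTrace B) := by
  rw [Set.disjoint_left]
  rintro ⟨p, hp⟩ hpA hpB
  change p ∈ closure (higsonMap '' A) at hpA
  change p ∈ closure (higsonMap '' B) at hpB
  have hclose := asymptoticallyDisjoint_iff.1 h
  have hS := hclose 1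
  -- Only a bounded set is removed, so `p` stays in the closure, and the denominator becomes
  -- positive everywhere.
  set A₁ := A \ {a | a ∈ A ∧ ∃ b ∈ B, dist a b ≤ 1} with hA₁
  have hpA₁ : p ∈ closure (higsonMap '' A₁) := mem_closure_diff_of_isBounded hp hS hpA
  have hneA : A₁.Nonempty := by
    rw [← image_nonempty (f := higsonMap), ← closure_nonempty_iff]
    exact ⟨p, hpA₁⟩
  have hneB : B.Nonempty := by
    rw [← image_nonempty (f := higsonMap), ← closure_nonempty_iff]
    exact ⟨p, hpB⟩
  have hu0 : ∀ x : X, 0 ≤ Metric.infDist x A₁ := fun x => Metric.infDist_nonneg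
  have hv0 : ∀ x : X, 0 ≤ Metric.infDist x B := fun x => Metric.infDist_nonneg
  have hpoint : ∀ (x : X) (M : ℝ), Metric.infDist x A₁ + Metric.infDist x B < M →
      ∃ a ∈ A₁, ∃ b ∈ B, dist x a < M ∧ dist a b < M := by
    intro x M hM
    set δ := (M - (Metric.infDist x A₁ + Metric.infDist x B)) / 2 with hδ
    have hδ0 : 0 < δ := by rw [hδ]; linarith
    obtain ⟨a, ha, hxa⟩ := (Metric.infDist_lt_iff hneA).1
      (lt_add_of_pos_right (Metric.infDist x A₁) hδ0)
    obtain ⟨b, hb, hxb⟩ := (Metric.infDist_lt_iff hneB).1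
      (lt_add_of_pos_right (Metric.infDist x B) hδ0)
    have := dist_triangle_left a b x
    have := hv0 x
    exact ⟨a, ha, b, hb, by linarith, by linarith⟩
  have hpos : ∀ x : X, 0 < Metric.infDist x A₁ + Metric.infDist x B := by
    intro x
    by_contra hle
    obtain ⟨a, ha, b, hb, -, hab⟩ := hpoint x 1 (by linarith)
    exact ha.2 ⟨ha.1, b, hb, hab.le⟩
  let f : X → unitInterval := fun x =>
    ⟨Metric.infDist x A₁ / (Metric.infDist x A₁ + Metric.infDist x B),
      div_nonneg (hu0 x) (hpos x).le,
      (div_le_one (hpos x)).2 (le_add_of_nonneg_right (hv0 x))⟩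
  have hf : SlowlyOscillating f := by
    refine slowlyOscillating_div (Metric.lipschitz_infDist_pt A₁) (Metric.lipschitz_infDist_pt B)
      hu0 hv0 (fun x => rfl) fun x₀ M => ?_
    obtain ⟨r, hr⟩ := (hclose M).subset_ball x₀
    refine ⟨r + M, fun x hx => ?_⟩
    by_contra hlt
    obtain ⟨a, ha, b, hb, hxa, hab⟩ := hpoint x M (not_le.1 hlt)
    have h1 : dist a x₀ < r := hr ⟨ha.1, b, hb, hab.le⟩
    have := dist_triangle x a x₀
    linarith
  have hcont : Continuous f := by
    refine Continuous.subtype_mk ?_ _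
    exact (Metric.continuous_infDist_pt _).div
      ((Metric.continuous_infDist_pt _).add (Metric.continuous_infDist_pt _))
      fun x => (hpos x).ne'
  let φ : HigsonFun X := ⟨⟨f, hcont⟩, hf⟩
  have h0 : p φ = 0 := by
    refine closure_minimal (t := {q : HigsonFun X → unitInterval | q φ = 0}) ?_
      (isClosed_eq (continuous_apply φ) continuous_const) hpA₁
    rintro _ ⟨y, hy, rfl⟩
    refine Subtype.ext ?_
    change Metric.infDist y A₁ / _ = 0
    rw [Metric.infDist_zero_of_mem hy, zero_div]
  have h1 : p φ = 1 := by
    refine closure_minimal (t := {q : HigsonFun X → unitInterval | q φ = 1}) ?_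
      (isClosed_eq (continuous_apply φ) continuous_const) hpB
    rintro _ ⟨y, hy, rfl⟩
    refine Subtype.ext ?_
    have hy' := hpos y
    change Metric.infDist y A₁ / (Metric.infDist y A₁ + Metric.infDist y B) = 1
    rw [Metric.infDist_zero_of_mem hy, add_zero] at hy' ⊢
    exact div_self hy'.ne'
  rw [h0] at h1
  exact zero_ne_one h1

/-- Otherwise points `a n`, `b n` escape to infinity at mutual distance below `R`. Slow oscillation
gives every Higson function the same limit along both, so an ultrafilter limit lies in both traces.
-/
theorem asymptoticallyDisjoint_of_disjoint_higsonTrace {A B : Set X}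
    (h : Disjoint (higsonTrace A) (higsonTrace B)) : AsymptoticallyDisjoint A B := by
  by_contra hnot
  simp only [AsymptoticallyDisjoint, not_forall, not_exists, not_le] at hnot
  obtain ⟨x₀, R, hR⟩ := hnot
  choose a ha b hb hab using fun n : ℕ => hR n
  let U : Ultrafilter ℕ := Ultrafilter.of Filter.atTop
  have hU : (U : Filter ℕ) ≤ Filter.atTop := Ultrafilter.of_le _
  obtain ⟨p, -, hp⟩ := isCompact_univ.ultrafilter_le_nhds (U.map fun n => higsonMap (a n))
    (by simp)
  have hpa : Filter.Tendsto (fun n => higsonMap (a n)) U (nhds p) := hp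
  have hdist : ∀ φ : HigsonFun X,
      Filter.Tendsto (fun n => dist (φ.1 (a n)) (φ.1 (b n))) U (nhds 0) := by
    intro φ
    refine Filter.Tendsto.mono_left ?_ hU
    rw [Metric.tendsto_atTop]
    intro ε hε
    have hR0 : 0 < R := dist_nonneg.trans_lt (hab 0)
    obtain ⟨D, -, hD⟩ := φ.2 x₀ R hR0 ε hε
    refine ⟨⌈D⌉₊, fun n hn => ?_⟩
    rw [Real.dist_0_eq_abs, abs_of_nonneg dist_nonneg]
    have hn' : (n : ℝ) ≤ dist (a n) x₀ := by simpa using (ha n).2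
    refine lt_of_le_of_lt (Metric.dist_le_diam_of_mem
      (isCompact_univ.isBounded.subset (subset_univ _)) ?_ ?_) (hD (a n) ?_)
    · exact mem_image_of_mem _ (Metric.mem_ball_self hR0)
    · exact mem_image_of_mem _ (by rw [Metric.mem_ball, dist_comm]; exact hab n)
    · exact (Nat.le_of_ceil_le hn).trans hn'
  have hpb : Filter.Tendsto (fun n => higsonMap (b n)) U (nhds p) := by
    rw [tendsto_pi_nhds] at hpa ⊢
    intro φ
    exact (tendsto_iff_of_dist (hdist φ)).1 (hpa φ)
  have hcorona : p ∈ higsonCoronaSet X := by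
    refine ⟨mem_closure_of_tendsto hpa (Filter.Eventually.of_forall fun n => mem_range_self _),
      fun S hS => mem_closure_of_tendsto hpa ?_⟩
    obtain ⟨r, hr⟩ := hS.subset_ball x₀
    refine hU ?_
    filter_upwards [Filter.eventually_ge_atTop ⌈r⌉₊] with n hn
    refine mem_image_of_mem _ fun hS' => (ha n).2 ?_
    exact Metric.ball_subset_ball (Nat.le_of_ceil_le hn) (hr hS')
  refine h.notMem_of_mem_left (a := ⟨p, hcorona⟩) ?_ ?_
  · exact mem_closure_of_tendsto hpa
      (Filter.Eventually.of_forall fun n => mem_image_of_mem _ (ha n).1)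
  · exact mem_closure_of_tendsto hpb
      (Filter.Eventually.of_forall fun n => mem_image_of_mem _ (hb n).1)

theorem isClosed_higsonTrace (C : Set X) : IsClosed (higsonTrace C) :=
  isClosed_closure.preimage continuous_subtype_val

/-- A point of the corona outside the trace of `D` lies in the trace of a set asymptotically
disjoint from `D`. -/
theorem exists_asymptoticallyDisjoint_of_notMem_higsonTrace {D : Set X} {p : HigsonCorona X}
    (hp : p ∉ higsonTrace D) : ∃ F : Set X, AsymptoticallyDisjoint F D ∧ p ∈ higsonTrace F := by
  have hD : (closure (higsonMap '' D))ᶜ ∈ nhds (p : HigsonFun X → unitInterval) :=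
    isClosed_closure.isOpen_compl.mem_nhds hp
  -- By regularity, a closed neighbourhood of `p` misses the closure of `D`; its preimage in `X`
  -- serves as `F`.
  obtain ⟨K, hK, hKc, hKD⟩ := exists_mem_nhds_isClosed_subset hD
  refine ⟨higsonMap ⁻¹' K, ?_, ?_⟩
  · refine asymptoticallyDisjoint_of_disjoint_higsonTrace (Set.disjoint_left.2 fun q hq hqD => ?_)
    exact hKD (closure_minimal (image_preimage_subset _ _) hKc hq) hqD
  · change (p : HigsonFun X → unitInterval) ∈ closure _
    rw [mem_closure_iff_nhds]
    intro t ht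
    obtain ⟨_, ⟨hqt, hqK⟩, x, rfl⟩ := mem_closure_iff_nhds.1 p.2.1 _ (Filter.inter_mem ht hK)
    exact ⟨_, hqt, x, hqK, rfl⟩

end Asymptotics

/-! ### Nets of variable mesh -/

/-- A greedy net of `W` whose mesh at `y` is `K * s y`, obtained by choosing points of small mesh first. -/
theorem exists_net {Y : Type u} [MetricSpace Y] (W : Set Y) (s : Y → ℕ) (K : ℝ) (hK : 0 ≤ K) :
    ∃ D ⊆ W, (∀ x ∈ D, ∀ y ∈ D, x ≠ y → K * s x ≤ dist x y) ∧
      ∀ y ∈ W, ∃ x ∈ D, dist y x ≤ K * s y := by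
  let e : Y → ℕ × Y := fun y => (s y, y)
  let r : Y → Y → Prop := InvImage (Prod.Lex (· < ·) WellOrderingRel) e
  have hr : WellFounded r :=
    InvImage.wf e (WellFounded.prod_lex wellFounded_lt WellOrderingRel.isWellOrder.wf)
  have hrs : ∀ {x y}, r x y → s x ≤ s y := by
    intro x y h
    rcases (Prod.lex_def.1 h) with h | ⟨h, -⟩
    · exact le_of_lt h
    · exact le_of_eq h
  have hrt : ∀ {x y}, x ≠ y → r x y ∨ r y x := by
    intro x y hxy
    rcases lt_trichotomy (s x) (s y) with h | h | h
    · exact Or.inl (Prod.lex_def.2 (Or.inl h))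
    · rcases trichotomous_of WellOrderingRel x y with h' | h' | h'
      · exact Or.inl (Prod.lex_def.2 (Or.inr ⟨h, h'⟩))
      · exact absurd h' hxy
      · exact Or.inr (Prod.lex_def.2 (Or.inr ⟨h.symm, h'⟩))
    · exact Or.inr (Prod.lex_def.2 (Or.inl h))
  -- A point is kept unless an earlier kept point is within its own mesh. Earlier points have
  -- smaller `s`, so kept pairs are separated at the larger of their two meshes.
  let P : Y → Prop := hr.fix fun y ih => y ∈ W ∧ ∀ x (h : r x y), ih x h → K * s y ≤ dist x y
  have hP : ∀ y, P y ↔ (y ∈ W ∧ ∀ x, r x y → P x → K * s y ≤ dist x y) := by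
    intro y
    exact iff_of_eq (hr.fix_eq _ y)
  refine ⟨{y | P y}, fun y hy => ((hP y).1 hy).1, ?_, ?_⟩
  · intro x hx y hy hxy
    rcases hrt hxy with h | h
    · have h1 := ((hP y).1 hy).2 x h hx
      have h2 : (s x : ℝ) ≤ s y := by exact_mod_cast hrs h
      exact (mul_le_mul_of_nonneg_left h2 hK).trans h1
    · rw [dist_comm]
      exact ((hP x).1 hx).2 y h hy
  · intro y hy
    by_cases hPy : P y
    · exact ⟨y, hPy, by rw [dist_self]; positivity⟩
    · rw [hP] at hPy
      push Not at hPy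
      obtain ⟨x, -, hPx, hlt⟩ := hPy hy
      exact ⟨x, hPx, by rw [dist_comm]; exact hlt.le⟩

/-! ### Bilipschitz maps and induced maps of coronas -/

/-- `j` distorts distances at most by the factor `L` in either direction. -/
structure IsBilipschitz {Y X : Type*} [MetricSpace Y] [MetricSpace X] (L : ℝ) (j : Y → X) :
    Prop where
  one_le : 1 ≤ L
  dist_map_le : ∀ y z, dist (j y) (j z) ≤ L * dist y z
  dist_le : ∀ y z, dist y z ≤ L * dist (j y) (j z)

namespace IsBilipschitz

variable {X Y : Type u} [MetricSpace X] [MetricSpace Y] {L : ℝ} {j : Y → X}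

theorem continuous (hj : IsBilipschitz L j) : Continuous j :=
  (LipschitzWith.of_dist_le_mul (K := ⟨L, zero_le_one.trans hj.one_le⟩)
    hj.dist_map_le).continuous

theorem isBounded_preimage (hj : IsBilipschitz L j) {S : Set X} (hS : Bornology.IsBounded S) :
    Bornology.IsBounded (j ⁻¹' S) := by
  obtain ⟨M, hM⟩ := Metric.isBounded_iff.1 hS
  exact Metric.isBounded_iff.2 ⟨L * M, fun y hy z hz => (hj.dist_le y z).trans
    (mul_le_mul_of_nonneg_left (hM hy hz) (zero_le_one.trans hj.one_le))⟩

theorem isBounded_image (hj : IsBilipschitz L j) {S : Set Y} (hS : Bornology.IsBounded S) :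
    Bornology.IsBounded (j '' S) := by
  obtain ⟨M, hM⟩ := Metric.isBounded_iff.1 hS
  refine Metric.isBounded_iff.2 ⟨L * M, ?_⟩
  rintro _ ⟨y, hy, rfl⟩ _ ⟨z, hz, rfl⟩
  exact (hj.dist_map_le y z).trans
    (mul_le_mul_of_nonneg_left (hM hy hz) (zero_le_one.trans hj.one_le))

theorem slowlyOscillating_comp (hj : IsBilipschitz L j) {φ : X → unitInterval}
    (hφ : SlowlyOscillating φ) : SlowlyOscillating (φ ∘ j) := by
  intro y₀ r hr ε hε
  have hL : 0 < L := zero_lt_one.trans_le hj.one_le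
  obtain ⟨D, hD0, hD⟩ := hφ (j y₀) (L * r) (by positivity) ε hε
  refine ⟨L * D, by positivity, fun y hy => ?_⟩
  refine lt_of_le_of_lt (Metric.diam_mono ?_ (isCompact_univ.isBounded.subset (subset_univ _)))
    (hD (j y) (le_of_mul_le_mul_left (hy.trans (hj.dist_le y y₀)) hL))
  rw [image_comp]
  refine image_mono ?_
  rintro _ ⟨z, hz, rfl⟩
  exact (hj.dist_map_le z y).trans_lt (mul_lt_mul_of_pos_left hz hL)

/-- Restriction of Higson functions along a bilipschitz map. -/
def higsonFunComp (hj : IsBilipschitz L j) (φ : HigsonFun X) : HigsonFun Y :=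
  ⟨⟨φ.1 ∘ j, φ.1.continuous.comp hj.continuous⟩, hj.slowlyOscillating_comp φ.2⟩

theorem mem_closure_image (hj : IsBilipschitz L j) {p : HigsonFun Y → unitInterval} {S : Set Y}
    (hp : p ∈ closure (higsonMap '' S)) :
    (fun φ => p (hj.higsonFunComp φ)) ∈ closure (higsonMap '' (j '' S)) := by
  have hc : Continuous fun (q : HigsonFun Y → unitInterval) (φ : HigsonFun X) =>
      q (hj.higsonFunComp φ) := continuous_pi fun φ => continuous_apply _
  refine map_mem_closure hc hp ?_
  rintro _ ⟨y, hy, rfl⟩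
  exact ⟨j y, mem_image_of_mem j hy, rfl⟩

/-- The map of Higson coronas induced by a bilipschitz map. -/
def coronaMap (hj : IsBilipschitz L j) (p : HigsonCorona Y) : HigsonCorona X :=
  ⟨fun φ => p.1 (hj.higsonFunComp φ), by
    refine ⟨?_, fun B hB => ?_⟩
    · have := hj.mem_closure_image (p := p.1) (S := univ)
        (by rw [image_univ]; exact p.2.1)
      refine closure_mono ?_ this
      exact image_subset_range _ _
    · refine closure_mono (image_mono ?_)
        (hj.mem_closure_image (p.2.2 _ (hj.isBounded_preimage hB)))
      rintro _ ⟨y, hy, rfl⟩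
      exact hy⟩

theorem continuous_coronaMap (hj : IsBilipschitz L j) : Continuous hj.coronaMap :=
  continuous_induced_rng.2 (continuous_pi fun φ =>
    (continuous_apply (hj.higsonFunComp φ)).comp continuous_subtype_val)

theorem coronaMap_mem_higsonTrace (hj : IsBilipschitz L j) {p : HigsonCorona Y} {S : Set Y}
    (hp : p ∈ higsonTrace S) : hj.coronaMap p ∈ higsonTrace (j '' S) :=
  hj.mem_closure_image hp

theorem asymptoticallyDisjoint_image (hj : IsBilipschitz L j) {A B : Set Y}
    (h : AsymptoticallyDisjoint A B) : AsymptoticallyDisjoint (j '' A) (j '' B) := by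
  rw [asymptoticallyDisjoint_iff] at h ⊢
  intro R
  refine (hj.isBounded_image (h (L * R))).subset ?_
  rintro _ ⟨⟨a, ha, rfl⟩, _, ⟨b, hb, rfl⟩, hab⟩
  exact ⟨a, ⟨ha, b, hb, (hj.dist_le a b).trans
    (mul_le_mul_of_nonneg_left hab (zero_le_one.trans hj.one_le))⟩, rfl⟩

/-! ### Pulling a separator back to the domain -/

/-- A set `C ⊆ X` asymptotically disjoint from the image of `E ⊆ Y` can be replaced by a closed
set `D ⊆ Y` which embeds into `C`, is asymptotically disjoint from `E`, and whose trace contains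
all points of the corona of `Y` over the trace of `C`. -/
theorem exists_closed_bilipschitz (hj : IsBilipschitz L j) {E : Set Y} {C : Set X}
    (hE : AsymptoticallyDisjoint (j '' E) C) :
    ∃ D : Set Y, IsClosed D ∧ (∃ g : D → C, IsBilipschitz (2 * L) g) ∧
      AsymptoticallyDisjoint E D ∧
      ∀ F : Set Y, AsymptoticallyDisjoint F D → AsymptoticallyDisjoint (j '' F) C := by
  have hL1 := hj.one_le
  have hL : 0 < L := zero_lt_one.trans_le hL1
  rw [asymptoticallyDisjoint_iff] at hE
  let W : Set Y := {y | ∃ c ∈ C, ∀ a ∈ E, dist (j y) c ≤ dist (j y) (j a)}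
  -- Adding 1 makes `s` exceed the distance to `C` strictly, so a point of `C` within `s y` exists,
  -- and bounds the mesh below, so `D` is uniformly discrete.
  let s : Y → ℕ := fun y => ⌈Metric.infDist (j y) C⌉₊ + 1
  have hs1 : ∀ y, (1 : ℝ) ≤ s y := fun y => by simp [s]
  have hs : ∀ y, ∀ c ∈ C, (s y : ℝ) ≤ dist (j y) c + 2 := by
    intro y c hc
    have h1 := Metric.infDist_le_dist_of_mem (x := j y) hc
    have h2 := Nat.ceil_lt_add_one (Metric.infDist_nonneg (x := j y) (s := C))
    simp only [s, Nat.cast_add, Nat.cast_one]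
    linarith
  have hsW : ∀ y ∈ W, ∃ c ∈ C, dist (j y) c < s y := by
    rintro y ⟨c, hc, -⟩
    refine (Metric.infDist_lt_iff ⟨c, hc⟩).1 ?_
    have := Nat.le_ceil (Metric.infDist (j y) C)
    simp only [s, Nat.cast_add, Nat.cast_one]
    linarith
  -- Separation `4 * L * max (s x) (s y)` is at least `2 * L * (s x + s y)`: the displacements to
  -- `C`, scaled by `L`, use up at most half of `dist x y`.
  obtain ⟨D, hDW, hsep, hnet⟩ := exists_net W s (4 * L) (by positivity)
  refine ⟨D, ?_, ?_, ?_, ?_⟩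
  · refine Metric.isClosed_of_pairwise_le_dist (ε := 4 * L) (by positivity) ?_
    intro x hx y hy hxy
    exact le_trans (le_mul_of_one_le_right (by positivity) (hs1 x)) (hsep x hx y hy hxy)
  · choose g hgC hg using fun x : D => hsW x (hDW x.2)
    have key : ∀ x y : D, x ≠ y →
        2 * L * (dist (j x) (g x) + dist (j y) (g y)) ≤ dist x y := by
      intro x y hxy
      have hxy' : (x : Y) ≠ y := fun h => hxy (Subtype.ext h)
      have h1 := hsep x x.2 y y.2 hxy'
      have h2 := hsep y y.2 x x.2 hxy'.symm
      rw [dist_comm] at h2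
      have h3 := mul_le_mul_of_nonneg_left (hg x).le (by positivity : 0 ≤ 4 * L)
      have h4 := mul_le_mul_of_nonneg_left (hg y).le (by positivity : 0 ≤ 4 * L)
      rw [Subtype.dist_eq]
      linarith
    refine ⟨fun x => ⟨g x, hgC x⟩, by linarith, ?_, ?_⟩
    · intro x y
      change dist (g x) (g y) ≤ _
      rcases eq_or_ne x y with rfl | hxy
      · simp
      have h1 := key x y hxy
      have h2 := dist_triangle4 (g x) (j x) (j y) (g y)
      have h3 := hj.dist_map_le x y
      rw [dist_comm (g x) (j x)] at h2
      have h4 : 0 ≤ dist (j x) (g x) + dist (j y) (g y) := by positivity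
      have h5 := mul_le_mul_of_nonneg_right (by linarith : 1 ≤ 2 * L) h4
      have h6 := mul_le_mul_of_nonneg_right hL1 (dist_nonneg (x := x) (y := y))
      rw [← Subtype.dist_eq] at h3
      linarith
    · intro x y
      change _ ≤ 2 * L * dist (g x) (g y)
      rcases eq_or_ne x y with rfl | hxy
      · simp
      have h1 := key x y hxy
      have h2 := dist_triangle4 (j x) (g x) (g y) (j y)
      have h3 := hj.dist_le x y
      rw [dist_comm (g y) (j y)] at h2
      have h4 := mul_le_mul_of_nonneg_left h2 hL.le
      rw [← Subtype.dist_eq] at h3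
      linarith
  · rw [asymptoticallyDisjoint_iff]
    intro R
    -- A net point `x` within `R` of `a ∈ E` has `j x` within `L * R` of both `j a` and, by the
    -- choice of `W`, some point of `C`.
    refine (hj.isBounded_preimage (hE (2 * (L * R) + 2))).subset ?_
    rintro a ⟨ha, x, hx, hax⟩
    obtain ⟨c, hc, hcE⟩ := hDW hx
    refine ⟨mem_image_of_mem j ha, c, hc, ?_⟩
    have h1 := hcE a ha
    have h2 := hj.dist_map_le a x
    have h3 := mul_le_mul_of_nonneg_left hax hL.le
    have h4 := dist_triangle (j a) (j x) c
    rw [dist_comm (j x) (j a)] at h1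
    linarith
  · intro F hF
    rw [asymptoticallyDisjoint_iff] at hF ⊢
    intro R
    refine ((hj.isBounded_image (hF (4 * L * (R + 2)))).union
      ((hE (2 * R)).cthickening (δ := R))).subset ?_
    rintro _ ⟨⟨y, hy, rfl⟩, c, hc, hyc⟩
    -- In `W`, closeness to `C` makes the mesh small, so `y` is near `D`. Outside `W`, some `j a`
    -- with `a ∈ E` is even closer to `j y` than `c` is, which forces `j y` near the bounded set
    -- where `j '' E` approaches `C`.
    by_cases hW : y ∈ W
    · obtain ⟨x, hx, hyx⟩ := hnet y hW
      refine Or.inl ⟨y, ⟨hy, x, hx, hyx.trans ?_⟩, rfl⟩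
      refine mul_le_mul_of_nonneg_left ?_ (by positivity)
      linarith [hs y c hc]
    · simp only [W, mem_ofPred_eq, not_exists, not_and, not_forall, not_le] at hW
      obtain ⟨a, ha, hac⟩ := hW c hc
      refine Or.inr (Metric.mem_cthickening_of_dist_le _ (j a) _ _ ⟨mem_image_of_mem j ha, c, hc, ?_⟩
        (hac.le.trans hyc))
      have := dist_triangle_left (j a) c (j y)
      linarith

/-! ### The transfinite induction -/

theorem trasIndLE (α : WithBot Ordinal.{u}) :
    ∀ {X Y : Type u} [MetricSpace X] [MetricSpace Y] {L : ℝ} {j : Y → X}, IsBilipschitz L j →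
      TrasIndLE α X → TrasIndLE α Y := by
  induction α using WellFoundedLT.induction with
  | ind α ih =>
  intro X Y _ _ L j hj hX
  rw [TrasIndLE] at hX ⊢
  refine ⟨fun hα => hj.isBounded_preimage (hX.1 hα), fun hα A B hAB => ?_⟩
  obtain ⟨C, ⟨-, V₁, V₂, hV₁, hV₂, hV, hCV, hAV, hBV⟩, β, hβ, hC⟩ :=
    hX.2 hα _ _ (hj.asymptoticallyDisjoint_image hAB)
  have hdisj : AsymptoticallyDisjoint (j '' (A ∪ B)) C := by
    refine asymptoticallyDisjoint_of_disjoint_higsonTrace (Set.disjoint_left.2 fun p hp hpC => ?_)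
    have hp' : p ∈ higsonTrace (j '' A) ∪ higsonTrace (j '' B) := by
      change (p : HigsonFun X → unitInterval) ∈ closure _ at hp
      rw [image_union, image_union, closure_union] at hp
      exact hp
    have : p ∈ (higsonTrace C)ᶜ := hCV ▸ union_subset_union hAV hBV hp'
    exact this hpC
  obtain ⟨D, hD, ⟨g, hg⟩, hED, hF⟩ := hj.exists_closed_bilipschitz hdisj
  have hEtr := hED.disjoint_higsonTrace
  have htr : ∀ S ⊆ A ∪ B, higsonTrace S ⊆ (higsonTrace D)ᶜ := fun S hS p hp hpD =>
    Set.disjoint_left.1 hEtr (closure_mono (image_mono hS) hp) hpD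
  have hCD : ∀ p : HigsonCorona Y, p ∉ higsonTrace D → hj.coronaMap p ∉ higsonTrace C := by
    intro p hp hpC
    obtain ⟨F, hFD, hpF⟩ := exists_asymptoticallyDisjoint_of_notMem_higsonTrace hp
    exact Set.disjoint_left.1 (hF F hFD).disjoint_higsonTrace
      (hj.coronaMap_mem_higsonTrace hpF) hpC
  have hDo : IsOpen (higsonTrace D)ᶜ := (isClosed_higsonTrace D).isOpen_compl
  -- The trace of `D` may exceed the preimage of the trace of `C`, so it is cut out of the
  -- pulled-back open sets. The induction hypothesis is applied to `g`, with constant `2 * L`.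
  refine ⟨D, ⟨hD, hj.coronaMap ⁻¹' V₁ ∩ (higsonTrace D)ᶜ, hj.coronaMap ⁻¹' V₂ ∩ (higsonTrace D)ᶜ,
    (hV₁.preimage hj.continuous_coronaMap).inter hDo,
    (hV₂.preimage hj.continuous_coronaMap).inter hDo, ?_, ?_, ?_, ?_⟩, β, hβ, ih β hβ hg hC⟩
  · exact (hV.preimage _).mono inter_subset_left inter_subset_left
  · rw [← union_inter_distrib_right, ← preimage_union, ← hCV]
    exact (inter_eq_right.2 fun p hp => hCD p hp).symm
  · exact subset_inter (fun p hp => hAV (hj.coronaMap_mem_higsonTrace hp))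
      (htr A subset_union_left)
  · exact subset_inter (fun p hp => hBV (hj.coronaMap_mem_higsonTrace hp))
      (htr B subset_union_right)

end IsBilipschitz

theorem isBilipschitz_subtype_val {X : Type u} [MetricSpace X] (Y : Set X) :
    IsBilipschitz 1 (Subtype.val : Y → X) :=
  ⟨le_rfl, fun y z => by rw [one_mul, Subtype.dist_eq], fun y z => by rw [one_mul, Subtype.dist_eq]⟩

theorem theorem4 {X : Type*} [MetricSpace X] [ProperSpace X] (Y : Set X) :
    trasInd Y ≤ trasInd X := by
  by_cases hX : {α | TrasIndLE α X}.Nonempty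
  · have hmem := wellFounded_lt.min_mem _ hX
    have hmemY := (isBilipschitz_subtype_val Y).trasIndLE _ hmem
    have hY : {α | TrasIndLE α Y}.Nonempty := ⟨_, hmemY⟩
    rw [trasInd, trasInd, dif_pos hX, dif_pos hY, WithTop.coe_le_coe]
    exact wellFounded_lt.min_le (s := {α | TrasIndLE α Y}) hmemY
  · rw [trasInd, trasInd, dif_neg hX]
    exact le_top
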